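/- Let $\mathbb{k}$ be a field and $R=\mathbb{k}[t^{-1},t]]$ the ring of Laurent series in $t$. Let $G$ be a braid graph on $b$ strands with no strands closed: it is obtained from an open $b$-strand braid diagram, oriented upwards, by replacing crossings by thick edges (joining two adjacent strands) or by the oriented smoothing (with bivalent vertices on the strands); every strand is assumed to meet at least one thick edge or bivalent vertex. A framing is a choice of an integer for each thin edge of $G$ (thick edges are blackboard framed). The strands are numbered $1,\dots,b$ from right to left. For $0\le k\le b-1$ let $G^{(k)}$ be obtained from $G$ by closing its rightmost $k$ strands, that is, by joining for each $i\le k$ the top boundary edge at position $i$ to the bottom boundary edge at position $i$, to form one thin edge whose framing is the sum of the two framings; all other framings are inherited from $G$. For a framed graph $H$, assign to each thin edge $e$ with framing $\ell_e$ the variables $x_e$ (first segment of $e$) and $y_e$ (second segment). The edge ring is $\mathcal{E}(H)=R[x_e]_e\cong R[x_e,y_e]_e/(t^{\ell_e}y_e-x_e)_e$, where the isomorphism retains the variables $x_e$. For a set $\Gamma$ of thick edges and bivalent vertices of $H$ let $w(\Gamma)$ be the sum of the framings of the thin edges that both start and end in $\Gamma$, let $x_{\Gamma,\mathrm{out}}$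 be the product of the $x_e$ over the thin edges $e$ that start in $\Gamma$ and do not end in $\Gamma$, and let $y_{\Gamma,\mathrm{in}}$ be the product of the $y_e$ over the thin edges $e$ that end in $\Gamma$ and do not start in $\Gamma$ (boundary edges included). The non-local ideal $N(H)\subset\mathcal{E}(H)$ is the ideal generated by the images of $t^{w(\Gamma)}x_{\Gamma,\mathrm{out}}-y_{\Gamma,\mathrm{in}}$, over all sets $\Gamma$. Write $z_\tau^{(i)}$ and $z_\beta^{(i)}$ for the $x$-variables of the top and bottom boundary edges of $G$ at position $i$, and $a_i$ for the framing of the top boundary edge of $G$ at position $i$. Closure edges keep the variable $z_\tau^{(i)}$, so that $\mathcal{E}(G^{(k)})$ is the polynomial ring over $R$ in the $x$-variables of $G$ other than $z_\beta^{(1)},\dots,z_\beta^{(k)}$. For $0\le k\le b-2$ let $\pi_k:\mathcal{E}(G^{(k)})\to\mathcal{E}(G^{(k+1)})$ be the quotient map with kernel $(z_\tau^{(k+1)}-t^{a_{k+1}}z_\beta^{(k+1)})$ that fixes all variables other than $z_\beta^{(k+1)}$ and sends $z_\beta^{(k+1)}$ to $t^{-a_{k+1}}z_\tau^{(k+1)}$.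 **Theorem.** For every framing of $G$ and every $0\le k\le b-2$, $$\pi_k\bigl(N(G^{(k)})\bigr):\bigl(z_\tau^{(k+1)}\bigr)=N\bigl(G^{(k+1)}\bigr)\quad\text{in }\mathcal{E}(G^{(k+1)}),$$ where $I:J=\{r : rJ\subseteq I\}$. -/

import Mathlib

open MvPolynomial

noncomputable section

namespace FramedBraid

/-! ### Framed graphs, edge rings and the non-local ideal -/

/-- The incidence data of a framed oriented graph with boundary. `V` is the set of thick edges and
bivalent vertices (a thick edge is regarded as one vertex with two incoming and two outgoing thin
edges), `E` is the set of thin edges. The value `none` of `source` or `target` means that this end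
of the thin edge is a univalent (boundary) vertex. -/
structure FramedGraph (V E : Type) where
  /-- the thick edge or bivalent vertex where a thin edge starts -/
  source : E → Option V
  /-- the thick edge or bivalent vertex where a thin edge ends -/
  target : E → Option V
  /-- the integer marking of a thin edge -/
  framing : E → ℤ

/-- The variable `t` of the ground ring `𝕜[t⁻¹, t]]` of Laurent series. -/
def tVar (𝕜 : Type*) [Field 𝕜] : LaurentSeries 𝕜 := HahnSeries.single 1 1

/-- The polynomial ring `R[x, y]` over the Laurent series, with two variables for each thin edge. -/
abbrev BigRing (𝕜 : Type*) [Field 𝕜] (E : Type) := MvPolynomial (E ⊕ E) (LaurentSeries 𝕜)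

/-- The variable of the first segment of a thin edge. -/
def xVar (𝕜 : Type*) [Field 𝕜] {E : Type} (e : E) : BigRing 𝕜 E := X (Sum.inl e)

/-- The variable of the second segment of a thin edge. -/
def yVar (𝕜 : Type*) [Field 𝕜] {E : Type} (e : E) : BigRing 𝕜 E := X (Sum.inr e)

/-- The edge ring `R[x]`, with one variable for each thin edge. -/
abbrev EdgeRing (𝕜 : Type*) [Field 𝕜] (E : Type) := MvPolynomial E (LaurentSeries 𝕜)

namespace FramedGraph

variable {V E : Type}

/-- The framing ideal, generated by `t ^ ℓ y - x` for each thin edge with framing `ℓ`. -/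
def framingIdeal (𝕜 : Type*) [Field 𝕜] (G : FramedGraph V E) : Ideal (BigRing 𝕜 E) :=
  Ideal.span (Set.range fun e : E => C (tVar 𝕜 ^ G.framing e) * yVar 𝕜 e - xVar 𝕜 e)

/-- The projection `R[x, y] → R[x]` that retains each `x` and replaces `y` by `t ^ (-ℓ) x`. -/
def toEdgeRing (𝕜 : Type*) [Field 𝕜] (G : FramedGraph V E) :
    BigRing 𝕜 E →ₐ[LaurentSeries 𝕜] EdgeRing 𝕜 E :=
  aeval (Sum.elim (fun e => X e) (fun e => C (tVar 𝕜 ^ (-G.framing e)) * X e))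

/-- The thin edge `e` starts at a member of `Γ`. -/
def StartsIn (G : FramedGraph V E) (Γ : Finset V) (e : E) : Prop := ∃ v ∈ Γ, G.source e = some v

/-- The thin edge `e` ends at a member of `Γ`. -/
def EndsIn (G : FramedGraph V E) (Γ : Finset V) (e : E) : Prop := ∃ v ∈ Γ, G.target e = some v

open Classical in
/-- The weight of `Γ`: the sum of the framings of the thin edges internal to `Γ`. -/
def weight [Fintype E] (G : FramedGraph V E) (Γ : Finset V) : ℤ :=
  ∑ e with G.StartsIn Γ e ∧ G.EndsIn Γ e, G.framing e

open Classical in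
/-- The product of the `x` variables of the thin edges that leave `Γ`. -/
def xOut (𝕜 : Type*) [Field 𝕜] [Fintype E] (G : FramedGraph V E) (Γ : Finset V) : BigRing 𝕜 E :=
  ∏ e with G.StartsIn Γ e ∧ ¬ G.EndsIn Γ e, xVar 𝕜 e

open Classical in
/-- The product of the `y` variables of the thin edges that enter `Γ`. -/
def yIn (𝕜 : Type*) [Field 𝕜] [Fintype E] (G : FramedGraph V E) (Γ : Finset V) : BigRing 𝕜 E :=
  ∏ e with ¬ G.StartsIn Γ e ∧ G.EndsIn Γ e, yVar 𝕜 e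

/-- The non-local ideal in `R[x, y]`. -/
def bigNonLocalIdeal (𝕜 : Type*) [Field 𝕜] [Fintype E] (G : FramedGraph V E) :
    Ideal (BigRing 𝕜 E) :=
  Ideal.span (Set.range fun Γ : Finset V =>
    C (tVar 𝕜 ^ G.weight Γ) * G.xOut 𝕜 Γ - G.yIn 𝕜 Γ)

/-- The non-local ideal in the edge ring: the image of the non-local ideal in `R[x, y]`. -/
def nonLocalIdeal (𝕜 : Type*) [Field 𝕜] [Fintype E] (G : FramedGraph V E) :
    Ideal (EdgeRing 𝕜 E) :=
  (G.bigNonLocalIdeal 𝕜).map (G.toEdgeRing 𝕜)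

end FramedGraph

theorem tVar_ne_zero (𝕜 : Type*) [Field 𝕜] : tVar 𝕜 ≠ 0 := by
  simp [tVar]

theorem FramedGraph.toEdgeRing_surjective (𝕜 : Type*) [Field 𝕜] {V E : Type}
    (G : FramedGraph V E) : Function.Surjective (G.toEdgeRing 𝕜) := by
  have h : (G.toEdgeRing 𝕜).comp (rename Sum.inl) = AlgHom.id _ _ := by
    ext e; simp [toEdgeRing]
  intro p
  exact ⟨rename Sum.inl p, by simpa using DFunLike.congr_fun h p⟩

/-- The edge ring is the quotient of `R[x, y]` by the framing ideal. -/
theorem FramedGraph.ker_toEdgeRing (𝕜 : Type*) [Field 𝕜] {V E : Type} (G : FramedGraph V E) :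
    RingHom.ker (G.toEdgeRing 𝕜) = G.framingIdeal 𝕜 := by
  have ht := tVar_ne_zero 𝕜
  apply le_antisymm
  · have h : ((Ideal.Quotient.mkₐ (LaurentSeries 𝕜) (G.framingIdeal 𝕜)).comp
        (rename Sum.inl)).comp (G.toEdgeRing 𝕜) =
        Ideal.Quotient.mkₐ (LaurentSeries 𝕜) (G.framingIdeal 𝕜) := by
      apply MvPolynomial.algHom_ext
      rintro (e | e)
      · simp [toEdgeRing]
      · have hm : (C (tVar 𝕜 ^ (-G.framing e)) : BigRing 𝕜 E) *
            (C (tVar 𝕜 ^ G.framing e) * yVar 𝕜 e - xVar 𝕜 e) ∈ G.framingIdeal 𝕜 :=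
          Ideal.mul_mem_left _ _ (Ideal.subset_span ⟨e, rfl⟩)
        rw [mul_sub, ← mul_assoc, ← C_mul, ← zpow_add₀ ht] at hm
        simp only [toEdgeRing, AlgHom.comp_apply, aeval_X, Sum.elim_inr,
          Ideal.Quotient.mkₐ_eq_mk]
        refine (Ideal.Quotient.eq.2 ?_).symm
        simpa [xVar, yVar] using hm
    intro p hp
    have hp' := DFunLike.congr_fun h p
    rw [RingHom.mem_ker] at hp
    simp only [AlgHom.comp_apply, Ideal.Quotient.mkₐ_eq_mk] at hp'
    rw [hp, map_zero, map_zero] at hp'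
    exact Ideal.Quotient.eq_zero_iff_mem.1 hp'.symm
  · rw [framingIdeal, Ideal.span_le]
    rintro _ ⟨e, rfl⟩
    simp [toEdgeRing, xVar, yVar, ← mul_assoc, ← C_mul, mul_inv_cancel₀ (zpow_ne_zero _ ht)]

/-! ### Braid graphs and their partial closures -/

/-- The elementary pieces of a braid graph on `b` strands. Positions are numbered from right to
left, starting with `0`; all edges are oriented upwards. -/
inductive Piece (b : ℕ) : Type
  /-- a thick edge joining the strands at the positions `i` and `i + 1` -/
  | thick (i : ℕ) (h : i + 1 < b) : Piece b
  /-- a bivalent vertex on the strand at the position `j` -/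
  | bivalent (j : Fin b) : Piece b

/-- The positions of the strands that a piece meets. A piece has one incoming (lower) and one
outgoing (upper) thin edge at each of these positions. -/
def Piece.positions {b : ℕ} : Piece b → Finset (Fin b)
  | .thick i h => {⟨i, Nat.lt_of_succ_lt h⟩, ⟨i + 1, h⟩}
  | .bivalent j => {j}

/-- A braid graph on `b` strands with no strands closed: a stack of thick edges and bivalent
vertices, listed from bottom to top. Every strand meets a thick edge or a bivalent vertex, since a
component of a graph has a vertex of degree greater than one. -/
structure BraidGraph (b : ℕ) where
  /-- the number of thick edges and bivalent vertices -/
  size : ℕ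
  /-- the thick edges and bivalent vertices from bottom to top -/
  piece : Fin size → Piece b
  exists_mem_positions : ∀ j : Fin b, ∃ v : Fin size, j ∈ (piece v).positions

namespace BraidGraph

variable {b : ℕ} (G : BraidGraph b)

/-- The thin edges. Each is determined by its lower end, which is either the bottom boundary point
at a position `j`, or the upper side of a thick edge or bivalent vertex `v` at a position `j`. -/
abbrev Edge : Type := Fin b ⊕ {p : Fin G.size × Fin b // p.2 ∈ (G.piece p.1).positions}

/-- The thick edges and bivalent vertices met by the strand at position `j`. -/
def onStrand (j : Fin b) : Finset (Fin G.size) := {v | j ∈ (G.piece v).positions}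

theorem onStrand_nonempty (j : Fin b) : (G.onStrand j).Nonempty := by
  obtain ⟨v, hv⟩ := G.exists_mem_positions j
  exact ⟨v, by simpa [onStrand] using hv⟩

/-- The lowest member of a set of thick edges and bivalent vertices, if there is one. -/
def lowest (s : Finset (Fin G.size)) : Option (Fin G.size) :=
  if h : s.Nonempty then some (s.min' h) else none

/-- The position of a thin edge. -/
def edgePos : G.Edge → Fin b
  | .inl j => j
  | .inr p => p.1.2

/-- The thick edge or bivalent vertex where a thin edge of the braid graph starts. -/
def edgeSource : G.Edge → Option (Fin G.size)
  | .inl _ => none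
  | .inr p => some p.1.1

/-- The thick edge or bivalent vertex where a thin edge of the braid graph ends: the next one that
its strand meets. -/
def edgeTarget : G.Edge → Option (Fin G.size)
  | .inl j => G.lowest (G.onStrand j)
  | .inr p => G.lowest {w ∈ G.onStrand p.1.2 | p.1.1 < w}

/-- The bottom boundary edge at position `j`. -/
def bottomEdge (j : Fin b) : G.Edge := .inl j

/-- The top boundary edge at position `j`. -/
def topEdge (j : Fin b) : G.Edge :=
  .inr ⟨((G.onStrand j).max' (G.onStrand_nonempty j), j), by
    simpa [onStrand] using (G.onStrand j).max'_mem (G.onStrand_nonempty j)⟩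

theorem topEdge_ne_bottomEdge (i j : Fin b) : G.topEdge i ≠ G.bottomEdge j := by
  simp [topEdge, bottomEdge]

/-- The thin edges of the graph in which the `k` rightmost strands are closed. The top and bottom
boundary edges at each closed position are joined to one closure edge, which keeps the name of the
top boundary edge, so the names of the bottom boundary edges are discarded. -/
abbrev ClosedEdge (k : ℕ) : Type :=
  {e : G.Edge // ∀ i : Fin b, (i : ℕ) < k → e ≠ G.bottomEdge i}

/-- The edge named by the top boundary edge at position `j`, in any partial closure. -/
def closedTopEdge (k : ℕ) (j : Fin b) : G.ClosedEdge k :=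
  ⟨G.topEdge j, fun i _ => G.topEdge_ne_bottomEdge j i⟩

instance (k : ℕ) : Fintype (G.ClosedEdge k) := Fintype.ofFinite _

/-- The thin edge `e` of the open braid graph is a top boundary edge at one of the `k` rightmost
positions. -/
def IsClosedTop (k : ℕ) (e : G.Edge) : Prop := (G.edgePos e : ℕ) < k ∧ e = G.topEdge (G.edgePos e)

open Classical in
/-- The framed graph obtained from the braid graph `G` with framing `ℓ` by closing the `k` rightmost
strands. A closure edge starts where the top boundary edge starts, ends where the bottom boundary
edge at the same position ends, and its framing is the sum of their framings. -/
def partialClosure (ℓ : G.Edge → ℤ) (k : ℕ) : FramedGraph (Fin G.size) (G.ClosedEdge k) where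
  source e := G.edgeSource e.1
  target e :=
    if G.IsClosedTop k e.1 then G.edgeTarget (G.bottomEdge (G.edgePos e.1)) else G.edgeTarget e.1
  framing e :=
    if G.IsClosedTop k e.1 then ℓ e.1 + ℓ (G.bottomEdge (G.edgePos e.1)) else ℓ e.1

/-- An edge that survives the closing of `k` strands and is not the bottom boundary edge at
position `k` also survives the closing of `k + 1` strands. -/
def ClosedEdge.next {G : BraidGraph b} {k : ℕ} (hk : k < b) (e : G.ClosedEdge k)
    (he : e.1 ≠ G.bottomEdge ⟨k, hk⟩) : G.ClosedEdge (k + 1) :=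
  ⟨e.1, fun i hi => by
    rcases Nat.lt_succ_iff_lt_or_eq.1 hi with h | h
    · exact e.2 i h
    · have : i = ⟨k, hk⟩ := Fin.ext h
      exact this ▸ he⟩

/-- The bottom boundary edge at position `k` when the strands at the positions below `k` are
closed. -/
def closedBottomEdge (k : ℕ) (hk : k < b) : G.ClosedEdge k :=
  ⟨G.bottomEdge ⟨k, hk⟩, fun i hi h => by
    have : i = ⟨k, hk⟩ := by simpa [bottomEdge] using h.symm
    simp [this] at hi⟩

open Classical in
/-- The projection of edge rings for the closing of the strand at position `k`. It retains the
variable of the top boundary edge and replaces the variable of the bottom boundary edge by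
`t ^ (-a)` times it, where `a` is the framing of the top boundary edge. -/
def closeStrand (𝕜 : Type*) [Field 𝕜] (ℓ : G.Edge → ℤ) (k : ℕ) (hk : k < b) :
    EdgeRing 𝕜 (G.ClosedEdge k) →ₐ[LaurentSeries 𝕜] EdgeRing 𝕜 (G.ClosedEdge (k + 1)) :=
  aeval fun e =>
    if he : e.1 = G.bottomEdge ⟨k, hk⟩ then
      C (tVar 𝕜 ^ (-ℓ (G.topEdge ⟨k, hk⟩))) * X (G.closedTopEdge (k + 1) ⟨k, hk⟩)
    else X (e.next hk he)

theorem closeStrand_surjective (𝕜 : Type*) [Field 𝕜] (ℓ : G.Edge → ℤ) (k : ℕ) (hk : k < b) :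
    Function.Surjective (G.closeStrand 𝕜 ℓ k hk) := by
  have h : (G.closeStrand 𝕜 ℓ k hk).comp
      (rename fun e : G.ClosedEdge (k + 1) => ⟨e.1, fun i hi => e.2 i (Nat.lt_succ_of_lt hi)⟩) =
      AlgHom.id _ _ := by
    apply MvPolynomial.algHom_ext
    intro e
    have : e.1 ≠ G.bottomEdge ⟨k, hk⟩ := e.2 ⟨k, hk⟩ (Nat.lt_succ_self k)
    simp [closeStrand, this, ClosedEdge.next]
  intro p
  exact ⟨_, DFunLike.congr_fun h p⟩

/-- The kernel of the projection is generated by `z_τ - t ^ a z_β`. -/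
theorem ker_closeStrand (𝕜 : Type*) [Field 𝕜] (ℓ : G.Edge → ℤ) (k : ℕ) (hk : k < b) :
    RingHom.ker (G.closeStrand 𝕜 ℓ k hk) = Ideal.span {X (G.closedTopEdge k ⟨k, hk⟩) -
      C (tVar 𝕜 ^ ℓ (G.topEdge ⟨k, hk⟩)) * X (G.closedBottomEdge k hk)} := by
  have ht := tVar_ne_zero 𝕜
  set Z : Ideal (EdgeRing 𝕜 (G.ClosedEdge k)) := Ideal.span {X (G.closedTopEdge k ⟨k, hk⟩) -
      C (tVar 𝕜 ^ ℓ (G.topEdge ⟨k, hk⟩)) * X (G.closedBottomEdge k hk)} with hZ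
  apply le_antisymm
  · have h : ((Ideal.Quotient.mkₐ (LaurentSeries 𝕜) Z).comp
        (rename fun e : G.ClosedEdge (k + 1) =>
          (⟨e.1, fun i hi => e.2 i (Nat.lt_succ_of_lt hi)⟩ : G.ClosedEdge k))).comp
        (G.closeStrand 𝕜 ℓ k hk) = Ideal.Quotient.mkₐ (LaurentSeries 𝕜) Z := by
      apply MvPolynomial.algHom_ext
      intro e
      by_cases he : e.1 = G.bottomEdge ⟨k, hk⟩
      · have hm : (C (tVar 𝕜 ^ (-ℓ (G.topEdge ⟨k, hk⟩))) : EdgeRing 𝕜 (G.ClosedEdge k)) *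
            (X (G.closedTopEdge k ⟨k, hk⟩) -
              C (tVar 𝕜 ^ ℓ (G.topEdge ⟨k, hk⟩)) * X (G.closedBottomEdge k hk)) ∈ Z :=
          Ideal.mul_mem_left _ _ (Ideal.subset_span rfl)
        rw [mul_sub, ← mul_assoc, ← C_mul, ← zpow_add₀ ht] at hm
        have hb : e = G.closedBottomEdge k hk := Subtype.ext he
        subst hb
        simp only [closeStrand, AlgHom.comp_apply, aeval_X, dif_pos he,
          Ideal.Quotient.mkₐ_eq_mk]
        refine Ideal.Quotient.eq.2 ?_
        simpa [closedTopEdge] using hm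
      · simp [closeStrand, he, ClosedEdge.next]
    intro p hp
    have hp' := DFunLike.congr_fun h p
    rw [RingHom.mem_ker] at hp
    simp only [AlgHom.comp_apply, Ideal.Quotient.mkₐ_eq_mk] at hp'
    rw [hp, map_zero, map_zero] at hp'
    exact Ideal.Quotient.eq_zero_iff_mem.1 hp'.symm
  · rw [hZ, Ideal.span_le, Set.singleton_subset_iff]
    have h1 := G.topEdge_ne_bottomEdge ⟨k, hk⟩ ⟨k, hk⟩
    simp [closeStrand, closedTopEdge, closedBottomEdge, h1, ClosedEdge.next, ← mul_assoc, ← C_mul,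
      mul_inv_cancel₀ (zpow_ne_zero _ ht)]

end BraidGraph

end FramedBraid

end

/-! Up to units, $N(H)$ is generated by the binomials
$t^{c(1_\Gamma)}x_{\mathrm{out}}-x_{\mathrm{in}}$, whose two exponents differ by the coboundary
$\delta 1_\Gamma$ and whose charge $c$ is additive in the potential. Peeling off superlevel sets of
a potential $g$ gives $t^{c(g)}x^{m'}\equiv x^m$ whenever $m'=m+\delta g$
(`mk_monomial_eq_of_coboundary`). So $N(H)$ behaves like a lattice ideal twisted by powers of $t$.
Cancelling a common variable does not change the difference of two exponents, so every variable is a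
nonzerodivisor modulo $N(H)$ (`mem_nonLocalIdeal_of_X_mul_mem`).

Closing a strand sends the binomial of $\Gamma$ to a unit times the new binomial of $\Gamma$, with
an extra factor $z_\tau$ when the closure edge is internal to $\Gamma$
(`exists_map_cutBinomial_eq`). Hence $z_\tau N(G^{(k+1)})\subseteq\pi_k(N(G^{(k)}))\subseteq
N(G^{(k+1)})$. The first inclusion bounds the colon ideal from below; the second, with $z_\tau$ a
nonzerodivisor, bounds it from above. -/

noncomputable section

namespace FramedBraid

namespace FramedGraph

variable {V E : Type}

/-! ### Potentials, coboundaries and charges -/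

/-- The coboundary of an integer potential on the vertices, taken to vanish on the boundary. -/
def coboundary (G : FramedGraph V E) (g : V → ℤ) (e : E) : ℤ :=
  (G.source e).elim 0 g - (G.target e).elim 0 g

/-- The sum of the framings of the thin edges, weighted by the potential of their targets. -/
def charge [Fintype E] (G : FramedGraph V E) (g : V → ℤ) : ℤ :=
  ∑ e, G.framing e * (G.target e).elim 0 g

theorem coboundary_neg (G : FramedGraph V E) (g : V → ℤ) (e : E) :
    G.coboundary (-g) e = -G.coboundary g e := by
  unfold coboundary
  cases G.source e <;> cases G.target e <;> (simp; try ring)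

theorem coboundary_add (G : FramedGraph V E) (g h : V → ℤ) (e : E) :
    G.coboundary (g + h) e = G.coboundary g e + G.coboundary h e := by
  unfold coboundary
  cases G.source e <;> cases G.target e <;> (simp; try ring)

theorem coboundary_sub (G : FramedGraph V E) (g h : V → ℤ) (e : E) :
    G.coboundary (g - h) e = G.coboundary g e - G.coboundary h e := by
  rw [sub_eq_add_neg, coboundary_add, coboundary_neg, sub_eq_add_neg]

theorem coboundary_zero (G : FramedGraph V E) (e : E) : G.coboundary 0 e = 0 := by
  unfold coboundary
  cases G.source e <;> cases G.target e <;> simp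

theorem charge_add [Fintype E] (G : FramedGraph V E) (g h : V → ℤ) :
    G.charge (g + h) = G.charge g + G.charge h := by
  unfold charge
  rw [← Finset.sum_add_distrib]
  refine Finset.sum_congr rfl fun e _ => ?_
  cases G.target e <;> (simp; try ring)

theorem charge_zero [Fintype E] (G : FramedGraph V E) : G.charge 0 = 0 := by
  simpa using G.charge_add 0 0

theorem charge_neg [Fintype E] (G : FramedGraph V E) (g : V → ℤ) :
    G.charge (-g) = -G.charge g := by
  have h := G.charge_add g (-g)
  rw [add_neg_cancel, charge_zero] at h
  linarith

theorem charge_sub [Fintype E] (G : FramedGraph V E) (g h : V → ℤ) :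
    G.charge (g - h) = G.charge g - G.charge h := by
  rw [sub_eq_add_neg, charge_add, charge_neg, sub_eq_add_neg]

open Classical in
/-- The indicator potential of a set of vertices. -/
def indicator (Γ : Finset V) (v : V) : ℤ := if v ∈ Γ then 1 else 0

open Classical in
theorem elim_source_indicator (G : FramedGraph V E) (Γ : Finset V) (e : E) :
    (G.source e).elim 0 (indicator Γ) = if G.StartsIn Γ e then 1 else 0 := by
  unfold StartsIn
  cases G.source e <;> simp [indicator]

open Classical in
theorem elim_target_indicator (G : FramedGraph V E) (Γ : Finset V) (e : E) :
    (G.target e).elim 0 (indicator Γ) = if G.EndsIn Γ e then 1 else 0 := by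
  unfold EndsIn
  cases G.target e <;> simp [indicator]

/-! ### Normalized generators of the non-local ideal -/

open Classical in
/-- The exponent of the product of the variables of the thin edges that leave `Γ`. -/
def outExp [Fintype E] (G : FramedGraph V E) (Γ : Finset V) : E →₀ ℕ :=
  Finsupp.equivFunOnFinite.symm fun e => if G.StartsIn Γ e ∧ ¬ G.EndsIn Γ e then 1 else 0

open Classical in
/-- The exponent of the product of the variables of the thin edges that enter `Γ`. -/
def inExp [Fintype E] (G : FramedGraph V E) (Γ : Finset V) : E →₀ ℕ :=
  Finsupp.equivFunOnFinite.symm fun e => if ¬ G.StartsIn Γ e ∧ G.EndsIn Γ e then 1 else 0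

/-- Internal edges occur in neither monomial, and for them the indicator values at source and target
cancel. -/
theorem outExp_sub_inExp [Fintype E] (G : FramedGraph V E) (Γ : Finset V) (e : E) :
    (G.outExp Γ e : ℤ) - G.inExp Γ e = G.coboundary (indicator Γ) e := by
  classical
  rw [coboundary, elim_source_indicator, elim_target_indicator]
  by_cases h1 : G.StartsIn Γ e <;> by_cases h2 : G.EndsIn Γ e <;>
    simp [outExp, inExp, h1, h2]

/-- The binomial of `Γ` in the edge ring, normalized so that the entering monomial is monic. -/
def cutBinomial (𝕜 : Type*) [Field 𝕜] [Fintype E] (G : FramedGraph V E) (Γ : Finset V) :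
    EdgeRing 𝕜 E :=
  monomial (G.outExp Γ) (tVar 𝕜 ^ G.charge (indicator Γ)) - monomial (G.inExp Γ) 1

theorem prod_filter_X {σ R : Type*} [Fintype σ] [CommRing R] (p : σ → Prop) [DecidablePred p] :
    ∏ e with p e, (X e : MvPolynomial σ R) =
      monomial (Finsupp.equivFunOnFinite.symm fun e => if p e then 1 else 0) 1 := by
  rw [monomial_eq, Finsupp.prod_fintype _ _ (by simp), Finset.prod_filter]
  simp [apply_ite]

open Classical in
theorem charge_indicator [Fintype E] (G : FramedGraph V E) (Γ : Finset V) :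
    G.charge (indicator Γ) = ∑ e with G.EndsIn Γ e, G.framing e := by
  simp only [charge, elim_target_indicator, mul_ite, mul_one, mul_zero, Finset.sum_filter]

open Classical in
theorem cutBinomial_eq (𝕜 : Type*) [Field 𝕜] [Fintype E] (G : FramedGraph V E) (Γ : Finset V) :
    G.cutBinomial 𝕜 Γ = C (tVar 𝕜 ^ ∑ e with G.EndsIn Γ e, G.framing e) *
      ∏ e with G.StartsIn Γ e ∧ ¬ G.EndsIn Γ e, X e -
        ∏ e with ¬ G.StartsIn Γ e ∧ G.EndsIn Γ e, X e := by
  rw [prod_filter_X, prod_filter_X, C_mul_monomial, mul_one, cutBinomial,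
    charge_indicator]
  rfl

theorem prod_zpow_const {ι K : Type*} [Field K] {q : K} (hq : q ≠ 0) (s : Finset ι) (f : ι → ℤ) :
    ∏ i ∈ s, q ^ f i = q ^ ∑ i ∈ s, f i := by
  classical
  induction s using Finset.induction_on with
  | empty => simp
  | insert a s ha ih => rw [Finset.prod_insert ha, Finset.sum_insert ha, zpow_add₀ hq, ih]

-- Each entering $y_e$ becomes $t^{-\ell_e}x_e$. Factoring out these units adds the framings of the
-- entering edges to the weight; the result is the charge, which, unlike the weight, is additive.
open Classical in
theorem toEdgeRing_binomial (𝕜 : Type*) [Field 𝕜] [Fintype E] (G : FramedGraph V E)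
    (Γ : Finset V) :
    G.toEdgeRing 𝕜 (C (tVar 𝕜 ^ G.weight Γ) * G.xOut 𝕜 Γ - G.yIn 𝕜 Γ) =
      C (tVar 𝕜 ^ (-∑ e with ¬ G.StartsIn Γ e ∧ G.EndsIn Γ e, G.framing e)) *
        G.cutBinomial 𝕜 Γ := by
  have ht := tVar_ne_zero 𝕜
  have hx : G.toEdgeRing 𝕜 (G.xOut 𝕜 Γ) = ∏ e with G.StartsIn Γ e ∧ ¬ G.EndsIn Γ e, X e := by
    rw [xOut, map_prod]
    exact Finset.prod_congr rfl fun e _ => by simp [toEdgeRing, xVar]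
  have hy : G.toEdgeRing 𝕜 (G.yIn 𝕜 Γ) =
      C (tVar 𝕜 ^ (-∑ e with ¬ G.StartsIn Γ e ∧ G.EndsIn Γ e, G.framing e)) *
        ∏ e with ¬ G.StartsIn Γ e ∧ G.EndsIn Γ e, X e := by
    rw [yIn, map_prod, ← Finset.sum_neg_distrib, ← prod_zpow_const ht, map_prod,
      ← Finset.prod_mul_distrib]
    exact Finset.prod_congr rfl fun e _ => by simp [toEdgeRing, yVar]
  have hC (c : LaurentSeries 𝕜) : G.toEdgeRing 𝕜 (C c) = C c :=
    (G.toEdgeRing 𝕜).commutes c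
  have hw : ∑ e with G.EndsIn Γ e, G.framing e =
      G.weight Γ + ∑ e with ¬ G.StartsIn Γ e ∧ G.EndsIn Γ e, G.framing e := by
    rw [weight, ← Finset.sum_filter_add_sum_filter_not (Finset.univ.filter (G.EndsIn Γ))
      (G.StartsIn Γ), Finset.filter_filter, Finset.filter_filter]
    simp only [and_comm]
  rw [map_sub, map_mul, hx, hy, hC, cutBinomial_eq, mul_sub, ← mul_assoc, ← C_mul,
    ← zpow_add₀ ht, hw]
  congr 4
  ring

theorem nonLocalIdeal_eq_span (𝕜 : Type*) [Field 𝕜] [Fintype E] (G : FramedGraph V E) :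
    G.nonLocalIdeal 𝕜 = Ideal.span (Set.range (G.cutBinomial 𝕜)) := by
  classical
  have ht := tVar_ne_zero 𝕜
  rw [nonLocalIdeal, bigNonLocalIdeal, Ideal.map_span]
  apply le_antisymm
  · rw [Ideal.span_le]
    rintro _ ⟨_, ⟨Γ, rfl⟩, rfl⟩
    change G.toEdgeRing 𝕜 _ ∈ _
    rw [toEdgeRing_binomial]
    exact Ideal.mul_mem_left _ _ (Ideal.subset_span ⟨Γ, rfl⟩)
  · rw [Ideal.span_le]
    rintro _ ⟨Γ, rfl⟩
    have h := Ideal.mul_mem_left _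
      (C (tVar 𝕜 ^ (∑ e with ¬ G.StartsIn Γ e ∧ G.EndsIn Γ e, G.framing e)))
      (Ideal.subset_span (Set.mem_image_of_mem (G.toEdgeRing 𝕜) (Set.mem_range_self Γ)) :
        _ ∈ Ideal.span (G.toEdgeRing 𝕜 '' Set.range fun Γ : Finset V =>
          C (tVar 𝕜 ^ G.weight Γ) * G.xOut 𝕜 Γ - G.yIn 𝕜 Γ))
    rw [toEdgeRing_binomial, ← mul_assoc, ← C_mul, ← zpow_add₀ ht, add_neg_cancel, zpow_zero,
      C_1, one_mul] at h
    exact h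

/-! ### The twisted lattice ideal and its saturation -/

/-- Monomials whose exponents differ by a coboundary agree modulo the non-local ideal, up to the
power of `t` given by the charge. -/
theorem mk_monomial_eq_of_coboundary (𝕜 : Type*) [Field 𝕜] [Fintype V] [Fintype E]
    (G : FramedGraph V E) (g : V → ℤ) (m m' : E →₀ ℕ)
    (h : ∀ e, (m' e : ℤ) = m e + G.coboundary g e) (c : LaurentSeries 𝕜) :
    Ideal.Quotient.mk (G.nonLocalIdeal 𝕜) (monomial m' (tVar 𝕜 ^ G.charge g * c)) =
      Ideal.Quotient.mk (G.nonLocalIdeal 𝕜) (monomial m c) := by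
  classical
  have ht := tVar_ne_zero 𝕜
  induction hn : ∑ v, (g v).natAbs using Nat.strong_induction_on generalizing g m m' c with
  | _ n ih =>
  -- One binomial is used for the superlevel set of $g$, which lowers $\sum_v|g(v)|$. This needs a
  -- positive value of $g$; otherwise $-g$ is used with $m$ and $m'$ exchanged.
  have peel : ∀ (g : V → ℤ) (m m' : E →₀ ℕ) (c : LaurentSeries 𝕜),
      (∀ e, (m' e : ℤ) = m e + G.coboundary g e) → ∑ v, (g v).natAbs = n → (∃ v, 0 < g v) →
      Ideal.Quotient.mk (G.nonLocalIdeal 𝕜) (monomial m' (tVar 𝕜 ^ G.charge g * c)) =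
        Ideal.Quotient.mk (G.nonLocalIdeal 𝕜) (monomial m c) := by
    intro g m m' c h hn ⟨v, hv⟩
    set Γ : Finset V := Finset.univ.filter fun v => 0 < g v with hΓ
    -- An edge entering $\Gamma$ has potential at least $1$ at its target and at most $0$ at its
    -- source (a boundary source counts as $0$), so its coboundary is at most $-1$. Since $m'\ge 0$,
    -- it occurs in $m$.
    have hle : G.inExp Γ ≤ m := by
      intro e
      by_cases he : ¬ G.StartsIn Γ e ∧ G.EndsIn Γ e
      · obtain ⟨hs, w, hw, hwe⟩ := he
        have h1 := h e
        have h2 : (G.source e).elim 0 g ≤ 0 := by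
          cases hse : G.source e with
          | none => simp
          | some u =>
            by_contra hu
            exact hs ⟨u, by simpa [hΓ] using hu, hse⟩
        have h3 : 0 < g w := by simpa [hΓ] using hw
        rw [coboundary, hwe, Option.elim_some] at h1
        have : 1 ≤ m e := by omega
        have h4 : G.inExp Γ e ≤ 1 := by
          simp only [inExp, Finsupp.coe_equivFunOnFinite_symm]
          split_ifs <;> simp
        exact h4.trans this
      · simp [inExp, he]
    obtain ⟨r, rfl⟩ := exists_add_of_le hle
    have hstep : Ideal.Quotient.mk (G.nonLocalIdeal 𝕜) (monomial (G.outExp Γ + r)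
        (tVar 𝕜 ^ G.charge (indicator Γ) * c)) =
        Ideal.Quotient.mk (G.nonLocalIdeal 𝕜) (monomial (G.inExp Γ + r) c) := by
      rw [Ideal.Quotient.eq, nonLocalIdeal_eq_span]
      have := Ideal.mul_mem_right (monomial r c) _
        (Ideal.subset_span (Set.mem_range_self Γ) : G.cutBinomial 𝕜 Γ ∈ _)
      simpa [cutBinomial, sub_mul, monomial_mul] using this
    rw [← hstep]
    have := ih (∑ v, ((g - indicator Γ) v).natAbs) ?_ (g - indicator Γ) (G.outExp Γ + r) m' ?_
      (tVar 𝕜 ^ G.charge (indicator Γ) * c) rfl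
    · rwa [← mul_assoc, ← zpow_add₀ ht, charge_sub, sub_add_cancel] at this
    · rw [← hn]
      refine Finset.sum_lt_sum (fun w _ => ?_) ⟨v, Finset.mem_univ v, ?_⟩
      · by_cases hw : 0 < g w <;> (simp [indicator, hΓ, hw]; try omega)
      · simp [indicator, hΓ, hv]; omega
    · intro e
      rw [h e, coboundary_sub, ← outExp_sub_inExp]
      push_cast [Finsupp.add_apply]
      ring
  by_cases hpos : ∃ v, 0 < g v
  · exact peel g m m' c h hn hpos
  by_cases hneg : ∃ v, 0 < (-g) v
  · have := peel (-g) m' m (tVar 𝕜 ^ G.charge g * c)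
      (fun e => by rw [h e, coboundary_neg]; ring) (by simpa using hn) hneg
    rw [← mul_assoc, ← zpow_add₀ ht, charge_neg, neg_add_cancel, zpow_zero, one_mul] at this
    exact this.symm
  · have hg : g = 0 := by
      funext v
      push Not at hpos hneg
      have h1 := hpos v
      have h2 := hneg v
      simp only [Pi.neg_apply] at h2
      simp only [Pi.zero_apply]
      omega
    subst hg
    have : m' = m := by
      ext e
      have := h e
      rw [coboundary_zero] at this
      omega
    rw [this, charge_zero, zpow_zero, one_mul]

/-- Every variable is a nonzerodivisor modulo the non-local ideal. -/
theorem mem_nonLocalIdeal_of_X_mul_mem (𝕜 : Type*) [Field 𝕜] [Fintype V] [Fintype E]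
    (G : FramedGraph V E) (e : E) (f : EdgeRing 𝕜 E) (hf : X e * f ∈ G.nonLocalIdeal 𝕜) :
    f ∈ G.nonLocalIdeal 𝕜 := by
  classical
  have ht := tVar_ne_zero 𝕜
  -- A pair $p=(m,g)$ witnesses $x^n\equiv t^{c(g)}x_e x^m$. Divisibility by $x_e$ is tested only up
  -- to coboundaries, so that division can descend to the quotient.
  let Divides (n : E →₀ ℕ) (p : (E →₀ ℕ) × (V → ℤ)) : Prop :=
    ∀ i, (((p.1 + Finsupp.single e 1 : E →₀ ℕ) i : ℕ) : ℤ) = n i + G.coboundary p.2 i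
  let class_ (p : (E →₀ ℕ) × (V → ℤ)) : EdgeRing 𝕜 E ⧸ G.nonLocalIdeal 𝕜 :=
    Ideal.Quotient.mk _ (monomial p.1 (tVar 𝕜 ^ G.charge p.2))
  -- Monomials not divisible in this sense go to $0$. The values lie in the quotient by $N$, where
  -- the choice of witness is immaterial: two witnesses for $n$ differ by a coboundary, as $x_e$
  -- cancels.
  let quot (n : E →₀ ℕ) : EdgeRing 𝕜 E ⧸ G.nonLocalIdeal 𝕜 :=
    if h : ∃ p, Divides n p then class_ h.choose else 0
  have quot_eq (n : E →₀ ℕ) (p) (hp : Divides n p) : quot n = class_ p := by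
    have h : ∃ p, Divides n p := ⟨p, hp⟩
    have hq := h.choose_spec
    simp only [quot, dif_pos h]
    have := G.mk_monomial_eq_of_coboundary 𝕜 (h.choose.2 - p.2) p.1 h.choose.1 (fun i => by
      have h1 := hp i
      have h2 := hq i
      rw [coboundary_sub]
      push_cast [Finsupp.add_apply] at h1 h2
      linarith) (tVar 𝕜 ^ G.charge p.2)
    rwa [← zpow_add₀ ht, charge_sub, sub_add_cancel] at this
  let ψ : EdgeRing 𝕜 E →ₗ[LaurentSeries 𝕜] EdgeRing 𝕜 E ⧸ G.nonLocalIdeal 𝕜 :=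
    (basisMonomials E (LaurentSeries 𝕜)).constr (LaurentSeries 𝕜) quot
  have hψ (n : E →₀ ℕ) (c : LaurentSeries 𝕜) : ψ (monomial n c) = c • quot n := by
    have h1 : ψ (monomial n 1) = quot n := by
      have := (basisMonomials E (LaurentSeries 𝕜)).constr_basis (LaurentSeries 𝕜) quot n
      rwa [coe_basisMonomials] at this
    rw [← h1, ← map_smul, smul_monomial, smul_eq_mul, mul_one]
  have hsmul (c d : LaurentSeries 𝕜) (m : E →₀ ℕ) :
      c • Ideal.Quotient.mk (G.nonLocalIdeal 𝕜) (monomial m d) =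
        Ideal.Quotient.mk (G.nonLocalIdeal 𝕜) (monomial m (c * d)) := by
    rw [← smul_eq_mul, ← smul_monomial]
    rfl
  have hX (f : EdgeRing 𝕜 E) : ψ (X e * f) = Ideal.Quotient.mk _ f := by
    induction f using MvPolynomial.induction_on' with
    | monomial u a =>
      have : X e * monomial u a = monomial (u + Finsupp.single e 1) a := by
        rw [X, monomial_mul, one_mul, add_comm]
      rw [this, hψ, quot_eq _ (u, 0) (fun i => by simp [coboundary_zero])]
      simp only [class_]
      rw [hsmul, charge_zero, zpow_zero, mul_one]
    | add p q hp hq => rw [mul_add, map_add, map_add, hp, hq]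
  -- The two exponents differ by $\delta 1_\Gamma$, so shifting the potential by $1_\Gamma$ carries
  -- witnesses for one to witnesses for the other.
  have hcut (n : E →₀ ℕ) (Γ : Finset V) :
      quot (n + G.inExp Γ) = tVar 𝕜 ^ G.charge (indicator Γ) • quot (n + G.outExp Γ) := by
    by_cases h : ∃ p, Divides (n + G.outExp Γ) p
    · obtain ⟨p, hp⟩ := h
      rw [quot_eq _ p hp, quot_eq (n + G.inExp Γ) (p.1, p.2 + indicator Γ) fun i => by
        have h1 := hp i
        have h2 := G.outExp_sub_inExp Γ i
        rw [coboundary_add]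
        push_cast [Finsupp.add_apply] at h1 ⊢
        linarith]
      simp only [class_]
      rw [hsmul, charge_add, ← zpow_add₀ ht, add_comm]
    · have h' : ¬ ∃ p, Divides (n + G.inExp Γ) p := by
        rintro ⟨p, hp⟩
        refine h ⟨(p.1, p.2 - indicator Γ), fun i => ?_⟩
        have h1 := hp i
        have h2 := G.outExp_sub_inExp Γ i
        rw [coboundary_sub]
        push_cast [Finsupp.add_apply] at h1 ⊢
        linarith
      simp only [quot, dif_neg h, dif_neg h', smul_zero]
  have hgen (a : EdgeRing 𝕜 E) (Γ : Finset V) : ψ (a * G.cutBinomial 𝕜 Γ) = 0 := by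
    induction a using MvPolynomial.induction_on' with
    | monomial u a =>
      rw [cutBinomial, mul_sub, monomial_mul, monomial_mul, map_sub, hψ, hψ, hcut, mul_one,
        smul_smul, sub_self]
    | add p q hp hq => rw [add_mul, map_add, hp, hq, add_zero]
  -- The map $\psi$ is linear only over the Laurent series, so the induction over the ideal must
  -- carry an arbitrary multiplier $a$.
  have hker (r : EdgeRing 𝕜 E) (hr : r ∈ G.nonLocalIdeal 𝕜) : ∀ a, ψ (a * r) = 0 := by
    rw [nonLocalIdeal_eq_span] at hr
    induction hr using Submodule.span_induction with
    | mem x hx => obtain ⟨Γ, rfl⟩ := hx; exact fun a => hgen a Γ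
    | zero => simp
    | add x y _ _ hx hy => intro a; rw [mul_add, map_add, hx, hy, add_zero]
    | smul c x _ hx => intro a; rw [smul_eq_mul, ← mul_assoc, hx]
  have h0 := hker _ hf 1
  rw [one_mul, hX] at h0
  exact Ideal.Quotient.eq_zero_iff_mem.1 h0

end FramedGraph

/-! ### Joining two boundary edges -/

namespace FramedGraph

/-- Let `H'` arise from `H` by joining an edge that ends at the boundary to an edge that starts
there, retaining the name `τ` of the former. The corresponding map of edge rings sends each cut
binomial of `H` to the one of `H'`, up to a unit and possibly a factor `X τ`. -/
theorem exists_map_cutBinomial_eq (𝕜 : Type*) [Field 𝕜] {V E E' : Type} [Fintype E] [Fintype E']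
    (H : FramedGraph V E) (H' : FramedGraph V E') (σ : Option E' ≃ E) (τ : E')
    (source_eq : ∀ e, H'.source e = H.source (σ (some e)))
    (source_none : H.source (σ none) = none)
    (target_eq : ∀ e ≠ τ, H'.target e = H.target (σ (some e)))
    (target_join : H'.target τ = H.target (σ none))
    (target_none : H.target (σ (some τ)) = none)
    (framing_eq : ∀ e ≠ τ, H'.framing e = H.framing (σ (some e)))
    (framing_join : H'.framing τ = H.framing (σ (some τ)) + H.framing (σ none))
    (π : EdgeRing 𝕜 E →ₐ[LaurentSeries 𝕜] EdgeRing 𝕜 E')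
    (map_some : ∀ e, π (X (σ (some e))) = X e)
    (map_none : π (X (σ none)) = C (tVar 𝕜 ^ (-H.framing (σ (some τ)))) * X τ) (Γ : Finset V) :
    ∃ j : ℤ, π (H.cutBinomial 𝕜 Γ) = C (tVar 𝕜 ^ j) * H'.cutBinomial 𝕜 Γ ∨
      π (H.cutBinomial 𝕜 Γ) = C (tVar 𝕜 ^ j) * (X τ * H'.cutBinomial 𝕜 Γ) := by
  classical
  have ht := tVar_ne_zero 𝕜
  -- The two edges to be joined are split off; all other edges contribute equally to both graphs.
  have prod_split {M : Type _} [CommMonoid M] (f : E → M) : ∏ e, f e =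
      f (σ none) * (f (σ (some τ)) * ∏ e ∈ Finset.univ.erase τ, f (σ (some e))) := by
    rw [← σ.prod_comp, Fintype.prod_option, ← Finset.mul_prod_erase _ _ (Finset.mem_univ τ)]
  have sum_split (f : E → ℤ) : ∑ e, f e =
      f (σ none) + (f (σ (some τ)) + ∑ e ∈ Finset.univ.erase τ, f (σ (some e))) := by
    rw [← σ.sum_comp, Fintype.sum_option, ← Finset.add_sum_erase _ _ (Finset.mem_univ τ)]
  have hS (e : E') : H.StartsIn Γ (σ (some e)) ↔ H'.StartsIn Γ e := by
    simp only [StartsIn, source_eq]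
  have hS0 : ¬ H.StartsIn Γ (σ none) := by simp [StartsIn, source_none]
  have hE (e : E') (he : e ≠ τ) : H.EndsIn Γ (σ (some e)) ↔ H'.EndsIn Γ e := by
    simp only [EndsIn, target_eq e he]
  have hEτ : ¬ H.EndsIn Γ (σ (some τ)) := by simp [EndsIn, target_none]
  have hE0 : H.EndsIn Γ (σ none) ↔ H'.EndsIn Γ τ := by simp only [EndsIn, target_join]
  set c : ℤ := ∑ e ∈ Finset.univ.erase τ, if H'.EndsIn Γ e then H'.framing e else 0
  set P : EdgeRing 𝕜 E' :=
    ∏ e ∈ Finset.univ.erase τ, if H'.StartsIn Γ e ∧ ¬ H'.EndsIn Γ e then X e else 1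
  set Q : EdgeRing 𝕜 E' :=
    ∏ e ∈ Finset.univ.erase τ, if ¬ H'.StartsIn Γ e ∧ H'.EndsIn Γ e then X e else 1
  have hH' : H'.cutBinomial 𝕜 Γ =
      C (tVar 𝕜 ^ ((if H'.EndsIn Γ τ then H'.framing τ else 0) + c)) *
        ((if H'.StartsIn Γ τ ∧ ¬ H'.EndsIn Γ τ then X τ else 1) * P) -
      (if ¬ H'.StartsIn Γ τ ∧ H'.EndsIn Γ τ then X τ else 1) * Q := by
    rw [cutBinomial_eq, Finset.sum_filter, Finset.prod_filter, Finset.prod_filter,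
      ← Finset.mul_prod_erase _ _ (Finset.mem_univ τ),
      ← Finset.mul_prod_erase _ _ (Finset.mem_univ τ),
      ← Finset.add_sum_erase _ _ (Finset.mem_univ τ)]
  have hc : (∑ e ∈ Finset.univ.erase τ,
      if H.EndsIn Γ (σ (some e)) then H.framing (σ (some e)) else 0) = c := by
    refine Finset.sum_congr rfl fun e he => ?_
    have he := Finset.ne_of_mem_erase he
    simp only [hE e he, framing_eq e he]
  have hP : (∏ e ∈ Finset.univ.erase τ, π (if H.StartsIn Γ (σ (some e)) ∧
      ¬ H.EndsIn Γ (σ (some e)) then X (σ (some e)) else 1)) = P := by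
    refine Finset.prod_congr rfl fun e he => ?_
    simp only [hE e (Finset.ne_of_mem_erase he), hS e, apply_ite π, map_some, map_one]
  have hQ : (∏ e ∈ Finset.univ.erase τ, π (if ¬ H.StartsIn Γ (σ (some e)) ∧
      H.EndsIn Γ (σ (some e)) then X (σ (some e)) else 1)) = Q := by
    refine Finset.prod_congr rfl fun e he => ?_
    simp only [hE e (Finset.ne_of_mem_erase he), hS e, apply_ite π, map_some, map_one]
  have hC (a : LaurentSeries 𝕜) : π (C a) = C a := π.commutes a
  have hH : π (H.cutBinomial 𝕜 Γ) =
      C (tVar 𝕜 ^ ((if H'.EndsIn Γ τ then H.framing (σ none) else 0) + c)) *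
        ((if H'.StartsIn Γ τ then X τ else 1) * P) -
      (if H'.EndsIn Γ τ then C (tVar 𝕜 ^ (-H.framing (σ (some τ)))) * X τ else 1) * Q := by
    rw [cutBinomial_eq, map_sub, map_mul, hC, Finset.sum_filter, Finset.prod_filter,
      Finset.prod_filter, map_prod, map_prod, prod_split, prod_split, sum_split, hc, hP, hQ]
    simp only [hS0, hE0, hS, hEτ, apply_ite π, map_some, map_none, map_one, false_and, and_false,
      if_false, not_false_iff, true_and, and_true, one_mul, zero_add]
  rw [hH, hH', framing_join]
  -- The unit differs from $1$ only if the joined edge ends in $\Gamma$: the old entering variable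
  -- then maps to $t^{-a}x_\tau$, with $a$ the framing of the upper edge. If the edge also starts in
  -- $\Gamma$, both monomials acquire $x_\tau$, although the joined edge is internal and absent from
  -- the new binomial.
  by_cases h1 : H'.StartsIn Γ τ <;> by_cases h2 : H'.EndsIn Γ τ <;>
    simp only [h1, h2, if_true, if_false, not_true, not_false_iff, and_true, and_false, one_mul,
      zero_add]
  · refine ⟨-H.framing (σ (some τ)), Or.inr ?_⟩
    have : H.framing (σ none) + c =
      -H.framing (σ (some τ)) + (H.framing (σ (some τ)) + H.framing (σ none) + c) := by ring
    rw [this, zpow_add₀ ht (-_), C_mul]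
    ring
  · exact ⟨0, Or.inl (by simp)⟩
  · refine ⟨-H.framing (σ (some τ)), Or.inl ?_⟩
    have : H.framing (σ none) + c =
      -H.framing (σ (some τ)) + (H.framing (σ (some τ)) + H.framing (σ none) + c) := by ring
    rw [this, zpow_add₀ ht (-_), C_mul]
    ring
  · exact ⟨0, Or.inl (by simp)⟩

end FramedGraph

/-! ### Closing one more strand of a braid graph -/

namespace BraidGraph

variable {b : ℕ} (G : BraidGraph b)

/-- An edge that survives the closing of `k + 1` strands also survives the closing of `k`. -/
def ClosedEdge.previous {G : BraidGraph b} {k : ℕ} (e : G.ClosedEdge (k + 1)) : G.ClosedEdge k :=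
  ⟨e.1, fun i hi => e.2 i (Nat.lt_succ_of_lt hi)⟩

open Classical in
/-- The edges that survive the closing of `k` strands are those that survive the closing of `k + 1`
strands and the bottom boundary edge at position `k`. -/
def closedEdgeEquiv (k : ℕ) (hk : k < b) : Option (G.ClosedEdge (k + 1)) ≃ G.ClosedEdge k where
  toFun o := o.elim (G.closedBottomEdge k hk) ClosedEdge.previous
  invFun e := if he : e.1 = G.bottomEdge ⟨k, hk⟩ then none else some (e.next hk he)
  left_inv o := by
    rcases o with _ | e
    · simp [closedBottomEdge]
    · have : e.1 ≠ G.bottomEdge ⟨k, hk⟩ := e.2 ⟨k, hk⟩ (Nat.lt_succ_self k)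
      simp [ClosedEdge.previous, ClosedEdge.next, this]
  right_inv e := by
    by_cases he : e.1 = G.bottomEdge ⟨k, hk⟩
    · simp only [dif_pos he, Option.elim_none]
      exact Subtype.ext he.symm
    · simp [he, ClosedEdge.previous, ClosedEdge.next]

theorem edgeTarget_topEdge (j : Fin b) : G.edgeTarget (G.topEdge j) = none := by
  have : ¬ ({w ∈ G.onStrand j | (G.onStrand j).max' (G.onStrand_nonempty j) < w}).Nonempty := by
    rintro ⟨w, hw⟩
    rw [Finset.mem_filter] at hw
    exact absurd (Finset.le_max' _ w hw.1) (not_le.2 hw.2)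
  simp only [edgeTarget, topEdge, lowest, dif_neg this]

theorem isClosedTop_succ_iff (k : ℕ) (hk : k < b) (e : G.Edge) (he : e ≠ G.topEdge ⟨k, hk⟩) :
    G.IsClosedTop (k + 1) e ↔ G.IsClosedTop k e := by
  refine ⟨fun ⟨h1, h2⟩ => ⟨?_, h2⟩, fun ⟨h1, h2⟩ => ⟨Nat.lt_succ_of_lt h1, h2⟩⟩
  rcases Nat.lt_succ_iff_lt_or_eq.1 h1 with h | h
  · exact h
  · have : G.edgePos e = ⟨k, hk⟩ := Fin.ext h
    exact absurd (this ▸ h2) he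

theorem isClosedTop_topEdge_iff (k : ℕ) (j : Fin b) :
    G.IsClosedTop k (G.topEdge j) ↔ (j : ℕ) < k := by
  simp [IsClosedTop, edgePos, topEdge]

theorem not_isClosedTop_bottomEdge (k : ℕ) (j : Fin b) : ¬ G.IsClosedTop k (G.bottomEdge j) :=
  fun h => G.topEdge_ne_bottomEdge _ _ h.2.symm

/-- Passing from $k$ to $k+1$ joins the top and bottom edges at position $k$, both still boundary
edges before, and alters no other edge, so the joining lemma applies. -/
theorem exists_closeStrand_cutBinomial_eq (𝕜 : Type*) [Field 𝕜] (ℓ : G.Edge → ℤ) (k : ℕ)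
    (hk : k < b) (Γ : Finset (Fin G.size)) :
    ∃ j : ℤ, G.closeStrand 𝕜 ℓ k hk ((G.partialClosure ℓ k).cutBinomial 𝕜 Γ) =
        C (tVar 𝕜 ^ j) * (G.partialClosure ℓ (k + 1)).cutBinomial 𝕜 Γ ∨
      G.closeStrand 𝕜 ℓ k hk ((G.partialClosure ℓ k).cutBinomial 𝕜 Γ) =
        C (tVar 𝕜 ^ j) * (X (G.closedTopEdge (k + 1) ⟨k, hk⟩) *
          (G.partialClosure ℓ (k + 1)).cutBinomial 𝕜 Γ) := by
  have htop (e : G.ClosedEdge (k + 1)) (he : e ≠ G.closedTopEdge (k + 1) ⟨k, hk⟩) :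
      e.1 ≠ G.topEdge ⟨k, hk⟩ := fun h => he (Subtype.ext h)
  have hpos : G.edgePos (G.topEdge ⟨k, hk⟩) = ⟨k, hk⟩ := rfl
  have h1 : G.IsClosedTop (k + 1) (G.topEdge ⟨k, hk⟩) :=
    (G.isClosedTop_topEdge_iff _ _).2 (Nat.lt_succ_self k)
  have h2 : ¬ G.IsClosedTop k (G.topEdge ⟨k, hk⟩) := fun h =>
    lt_irrefl k ((G.isClosedTop_topEdge_iff _ _).1 h)
  have h3 := G.not_isClosedTop_bottomEdge k ⟨k, hk⟩
  refine FramedGraph.exists_map_cutBinomial_eq 𝕜 _ _ (G.closedEdgeEquiv k hk)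
    (G.closedTopEdge (k + 1) ⟨k, hk⟩) (fun e => rfl) rfl ?_ ?_ ?_ ?_ ?_ _ ?_ ?_ Γ
  · intro e he
    have := G.isClosedTop_succ_iff k hk e.1 (htop e he)
    by_cases h : G.IsClosedTop k e.1 <;>
      simp [partialClosure, closedEdgeEquiv, ClosedEdge.previous, this, h]
  · simp [partialClosure, closedEdgeEquiv, closedTopEdge, closedBottomEdge, h1, h3, hpos]
  · simp [partialClosure, closedEdgeEquiv, ClosedEdge.previous, closedTopEdge, h2,
      edgeTarget_topEdge]
  · intro e he
    have := G.isClosedTop_succ_iff k hk e.1 (htop e he)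
    by_cases h : G.IsClosedTop k e.1 <;>
      simp [partialClosure, closedEdgeEquiv, ClosedEdge.previous, this, h]
  · simp [partialClosure, closedEdgeEquiv, ClosedEdge.previous, closedTopEdge, closedBottomEdge,
      h1, h2, h3, hpos]
  · intro e
    have : e.1 ≠ G.bottomEdge ⟨k, hk⟩ := e.2 ⟨k, hk⟩ (Nat.lt_succ_self k)
    simp [closeStrand, closedEdgeEquiv, ClosedEdge.previous, ClosedEdge.next, this]
  · simp [closeStrand, partialClosure, closedEdgeEquiv, ClosedEdge.previous, closedTopEdge,
      closedBottomEdge, h2]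

end BraidGraph

end FramedBraid

end

/-! ### The colon ideal -/

theorem theorem1p1 (𝕜 : Type*) [Field 𝕜] (b : ℕ) (G : FramedBraid.BraidGraph b)
    (ℓ : G.Edge → ℤ) (k : ℕ) (hk : k + 2 ≤ b) :
    (((G.partialClosure ℓ k).nonLocalIdeal 𝕜).map
        (G.closeStrand 𝕜 ℓ k (by omega))).colon
      (Ideal.span {(MvPolynomial.X (G.closedTopEdge (k + 1) ⟨k, by omega⟩) :
        FramedBraid.EdgeRing 𝕜 (G.ClosedEdge (k + 1)))} : Ideal _) =
    (G.partialClosure ℓ (k + 1)).nonLocalIdeal 𝕜 := by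
  have hkb : k < b := by omega
  have ht := FramedBraid.tVar_ne_zero 𝕜
  have hunit (j : ℤ) : (C (FramedBraid.tVar 𝕜 ^ (-j)) : FramedBraid.EdgeRing 𝕜
      (G.ClosedEdge (k + 1))) * C (FramedBraid.tVar 𝕜 ^ j) = 1 := by
    rw [← C_mul, ← zpow_add₀ ht, neg_add_cancel, zpow_zero, C_1]
  have hmap : ((G.partialClosure ℓ k).nonLocalIdeal 𝕜).map (G.closeStrand 𝕜 ℓ k hkb) ≤
      (G.partialClosure ℓ (k + 1)).nonLocalIdeal 𝕜 := by
    rw [FramedBraid.FramedGraph.nonLocalIdeal_eq_span,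
      FramedBraid.FramedGraph.nonLocalIdeal_eq_span, Ideal.map_span, Ideal.span_le]
    rintro _ ⟨_, ⟨Γ, rfl⟩, rfl⟩
    have hΓ := Ideal.subset_span
      (Set.mem_range_self (f := (G.partialClosure ℓ (k + 1)).cutBinomial 𝕜) Γ)
    obtain ⟨j, h | h⟩ := G.exists_closeStrand_cutBinomial_eq 𝕜 ℓ k hkb Γ
    · exact h ▸ Ideal.mul_mem_left _ _ hΓ
    · exact h ▸ Ideal.mul_mem_left _ _ (Ideal.mul_mem_left _ _ hΓ)
  apply le_antisymm
  · intro r hr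
    have := hmap (Submodule.mem_colon.1 hr _ (Ideal.subset_span rfl))
    rw [smul_eq_mul, mul_comm] at this
    exact (G.partialClosure ℓ (k + 1)).mem_nonLocalIdeal_of_X_mul_mem 𝕜 _ r this
  · rw [FramedBraid.FramedGraph.nonLocalIdeal_eq_span 𝕜 (G.partialClosure ℓ (k + 1)),
      Ideal.span_le]
    rintro _ ⟨Γ, rfl⟩
    refine Submodule.mem_colon.2 fun s hs => ?_
    obtain ⟨a, rfl⟩ := Ideal.mem_span_singleton'.1 hs
    have hΓ : (G.partialClosure ℓ k).cutBinomial 𝕜 Γ ∈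
        (G.partialClosure ℓ k).nonLocalIdeal 𝕜 := by
      rw [FramedBraid.FramedGraph.nonLocalIdeal_eq_span]
      exact Ideal.subset_span (Set.mem_range_self Γ)
    have hΓ' := Ideal.mem_map_of_mem (G.closeStrand 𝕜 ℓ k hkb) hΓ
    rw [smul_eq_mul]
    obtain ⟨j, h | h⟩ := G.exists_closeStrand_cutBinomial_eq 𝕜 ℓ k hkb Γ
    -- Here the new binomial itself lies in the image ideal, so the multiple by $z_\tau$ is taken by
    -- hand.
    · rw [h] at hΓ'
      have := Ideal.mul_mem_left _
        (a * X (G.closedTopEdge (k + 1) ⟨k, hkb⟩) * C (FramedBraid.tVar 𝕜 ^ (-j))) hΓ'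
      rwa [mul_assoc, ← mul_assoc (C _), hunit, one_mul, mul_comm] at this
    -- Here the image already carries the factor $z_\tau$; only the unit has to be removed.
    · rw [h] at hΓ'
      have := Ideal.mul_mem_left _ (a * C (FramedBraid.tVar 𝕜 ^ (-j))) hΓ'
      rwa [mul_assoc, ← mul_assoc (C _), hunit, one_mul, ← mul_assoc, mul_comm] at this
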